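/- Let $\mathcal{P}_4$ be the set of strict partitions $\lambda=(\lambda_1>\lambda_2>\cdots>\lambda_k)$ (finite sequences of distinct positive integers in decreasing order, including the empty partition) such that, for consecutive parts, (1) $\lambda_i-\lambda_{i+1}\equiv 2 \pmod 4$ if $\lambda_i,\lambda_{i+1}$ are both odd; (2) $\lambda_i-\lambda_{i+1}\equiv 0 \pmod 4$ if they are both even; (3) $\lambda_i-\lambda_{i+1}\equiv 3 \pmod 4$ if they have different parity; and (4) the smallest part, if there is one, is congruent to $1$ or $2$ modulo $4$. Let $|\lambda|$ be the sum of the parts of $\lambda$ and $e(\lambda)$ the number of its even parts. For complex $a,q$ with $|q|<1$ put $(a;q)_n=\prod_{i=0}^{n-1}(1-aq^i)$ for $n\ge 0$ and $(a;q)_\infty=\prod_{i=0}^{\infty}(1-aq^i)$. Then for every complex number $q$ with $|q|<1$, both of the following series converge absolutely, and $$\sum_{\lambda\in\mathcal{P}_4}(-1)^{e(\lambda)}q^{|\lambda|}=\sum_{n=0}^{\infty}\frac{(q;q^2)_n\,q^{n^2}}{(q^4;q^4)_n}=\frac{(q^2;q^4)_\infty^2}{(q;q^2)_\infty}.$$ 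-/

import Mathlib

namespace RestrictedGap

/-- A partition: a non-increasing finite sequence of positive integers. The empty sequence is
the partition of `0`. Its size is `l.sum`. -/
def IsPartition (l : List ℕ) : Prop :=
  l.Pairwise (· ≥ ·) ∧ ∀ a ∈ l, 0 < a

/-- A strict partition: a partition whose parts are distinct. -/
def IsStrictPartition (l : List ℕ) : Prop :=
  IsPartition l ∧ l.Nodup

/-- The gap condition on two consecutive parts, `a` followed by `b`. -/
def GapCondition (a b : ℕ) : Prop :=
  (Odd a → Odd b → (a : ℤ) - (b : ℤ) ≡ 2 [ZMOD 4]) ∧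
  (Even a → Even b → (a : ℤ) - (b : ℤ) ≡ 0 [ZMOD 4]) ∧
  (¬ (Even a ↔ Even b) → (a : ℤ) - (b : ℤ) ≡ 3 [ZMOD 4])

/-- The set `𝒫₄` of strict partitions whose consecutive parts satisfy the gap condition and whose
smallest part, when there is one, is congruent to `1` or `2` modulo `4`. -/
def P4 : Set (List ℕ) :=
  {l | IsStrictPartition l ∧ l.IsChain GapCondition ∧
    ∀ a ∈ l.getLast?, a ≡ 1 [MOD 4] ∨ a ≡ 2 [MOD 4]}

/-- The number `e(λ)` of even parts. -/
def numEven (l : List ℕ) : ℕ := l.countP (fun a => Even a)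

/-- The finite `q`-Pochhammer symbol `(a; q)_n`. -/
noncomputable def qPoch (a q : ℂ) (n : ℕ) : ℂ :=
  ∏ i ∈ Finset.range n, (1 - a * q ^ i)

/-- The infinite `q`-Pochhammer symbol `(a; q)_∞`. -/
noncomputable def qPochInf (a q : ℂ) : ℂ :=
  ∏' i : ℕ, (1 - a * q ^ i)

/-- For `|q| < 1` the product that defines `(a; q)_∞` converges. -/
theorem hasProd_qPochInf (a q : ℂ) (hq : ‖q‖ < 1) :
    HasProd (fun i : ℕ => 1 - a * q ^ i) (qPochInf a q) := by
  have h : Summable fun i : ℕ => ‖-(a * q ^ i)‖ := by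
    simp only [norm_neg, norm_mul, norm_pow]
    exact (summable_geometric_of_lt_one (norm_nonneg q) hq).mul_left _
  simpa only [qPochInf, sub_eq_add_neg] using (multipliable_one_add_of_summable h).hasProd

end RestrictedGap

namespace RestrictedGap

open Filter Topology

/-! Combinatorial half: the parts allowed in front of `l` are `base l + 1 + b + 4k` with `b ∈ {0,
1}` and `k ≥ 0`, so `P4` is in bijection with finite sequences of pairs `(b, k)`. Marking `base` by
`y`, removal of the largest part replaces `y` by `q * y` and splits off a factor summing to `q y² (1
+ s q y²) / (1 - q⁴ y⁴)`. Iterating from `y = 1` with `s = -1` gives the `n`-th term of the series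
(`tsum_weight_one`). Analytic half (`tsum_qPoch_series`): expand `(q;q²)_n / (-q²;q²)_n` by the
`q`-binomial theorem and interchange the two sums. Both remaining sums are again `q`-binomial,
giving `(-q;q²)_∞ / (-q²;q²)_∞`, which Euler's identity turns into the stated product. -/

/-! ### Finite and infinite `q`-Pochhammer symbols -/

theorem qPoch_succ (a q : ℂ) (n : ℕ) : qPoch a q (n + 1) = qPoch a q n * (1 - a * q ^ n) :=
  Finset.prod_range_succ _ _

theorem norm_mul_pow_lt_one {a q : ℂ} (ha : ‖a‖ < 1) (hq : ‖q‖ < 1) (n : ℕ) :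
    ‖a * q ^ n‖ < 1 := by
  rw [norm_mul, norm_pow]
  exact mul_lt_one_of_nonneg_of_lt_one_left (norm_nonneg _) ha
    (pow_le_one₀ (norm_nonneg _) hq.le)

theorem one_sub_mul_pow_ne_zero {a q : ℂ} (ha : ‖a‖ < 1) (hq : ‖q‖ < 1) (n : ℕ) :
    1 - a * q ^ n ≠ 0 := by
  intro h
  have h1 := norm_mul_pow_lt_one ha hq n
  rw [← sub_eq_zero.1 h, norm_one] at h1
  exact lt_irrefl _ h1

theorem qPoch_ne_zero {a q : ℂ} (ha : ‖a‖ < 1) (hq : ‖q‖ < 1) (n : ℕ) : qPoch a q n ≠ 0 :=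
  Finset.prod_ne_zero_iff.2 fun i _ => one_sub_mul_pow_ne_zero ha hq i

theorem tendsto_qPoch (a : ℂ) {q : ℂ} (hq : ‖q‖ < 1) :
    Tendsto (qPoch a q) atTop (𝓝 (qPochInf a q)) :=
  (hasProd_qPochInf a q hq).tendsto_prod_nat

theorem qPochInf_ne_zero {a q : ℂ} (ha : ‖a‖ < 1) (hq : ‖q‖ < 1) : qPochInf a q ≠ 0 := by
  have h : Summable fun i : ℕ => ‖-(a * q ^ i)‖ := by
    simp only [norm_neg, norm_mul, norm_pow]
    exact (summable_geometric_of_lt_one (norm_nonneg q) hq).mul_left _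
  have := tprod_one_add_ne_zero_of_summable (f := fun i : ℕ => -(a * q ^ i))
    (fun i => by simpa only [← sub_eq_add_neg] using one_sub_mul_pow_ne_zero ha hq i) h
  simpa only [qPochInf, sub_eq_add_neg] using this

theorem qPoch_mul_qPochInf (a : ℂ) {q : ℂ} (hq : ‖q‖ < 1) (n : ℕ) :
    qPoch a q n * qPochInf (a * q ^ n) q = qPochInf a q := by
  have h1 := (tendsto_qPoch (a * q ^ n) hq).const_mul (qPoch a q n)
  have h2 := (tendsto_qPoch a hq).comp (tendsto_add_atTop_nat n)
  refine tendsto_nhds_unique h1 (h2.congr fun k => ?_)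
  simp only [Function.comp, qPoch]
  rw [add_comm k n, Finset.prod_range_add]
  simp only [pow_add, mul_assoc]

theorem qPoch_mul_qPoch_neg (a q : ℂ) (n : ℕ) :
    qPoch a q n * qPoch (-a) q n = qPoch (a ^ 2) (q ^ 2) n := by
  simp only [qPoch]
  rw [← Finset.prod_mul_distrib]
  refine Finset.prod_congr rfl fun i _ => ?_
  ring

theorem norm_sq_lt_one {q : ℂ} (hq : ‖q‖ < 1) : ‖q ^ 2‖ < 1 := by
  rw [norm_pow]
  exact pow_lt_one₀ (norm_nonneg _) hq two_ne_zero

theorem qPochInf_mul_qPochInf_neg (a : ℂ) {q : ℂ} (hq : ‖q‖ < 1) :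
    qPochInf a q * qPochInf (-a) q = qPochInf (a ^ 2) (q ^ 2) :=
  tendsto_nhds_unique
    (((tendsto_qPoch a hq).mul (tendsto_qPoch (-a) hq)).congr (qPoch_mul_qPoch_neg a q))
    (tendsto_qPoch (a ^ 2) (norm_sq_lt_one hq))

/-- Splitting the factors according to the parity of their index. -/
theorem qPochInf_eq_even_mul_odd (a : ℂ) {q : ℂ} (hq : ‖q‖ < 1) :
    qPochInf a (q ^ 2) * qPochInf (a * q) (q ^ 2) = qPochInf a q := by
  have he := hasProd_qPochInf a (q ^ 2) (norm_sq_lt_one hq)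
  have ho := hasProd_qPochInf (a * q) (q ^ 2) (norm_sq_lt_one hq)
  refine HasProd.unique (HasProd.even_mul_odd (f := fun i : ℕ => 1 - a * q ^ i) ?_ ?_)
    (hasProd_qPochInf a q hq)
  · simpa only [pow_mul] using he
  · exact ho.congr_fun fun i => by ring

/-- Euler: the number of partitions into distinct parts is that into odd parts. -/
theorem qPochInf_neg_mul_qPochInf {q : ℂ} (hq : ‖q‖ < 1) :
    qPochInf (-q) q * qPochInf q (q ^ 2) = 1 := by
  have h1 := qPochInf_mul_qPochInf_neg q hq
  have h2 := qPochInf_eq_even_mul_odd q hq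
  have h0 := qPochInf_ne_zero (norm_sq_lt_one hq) (norm_sq_lt_one hq)
  rw [← sq] at h2
  rw [← h2] at h1
  -- The common factor to cancel is `(q²;q²)_∞`.
  refine mul_right_cancel₀ h0 ?_
  linear_combination h1

/-! ### Ratio test and the `q`-binomial theorem -/

theorem summable_norm_of_tendsto_ratio {f r : ℕ → ℂ} {ρ : ℂ} (hf : ∀ n, f (n + 1) = r n * f n)
    (hr : Tendsto r atTop (𝓝 ρ)) (hρ : ‖ρ‖ < 1) : Summable fun n => ‖f n‖ := by
  obtain ⟨s, hs, hs1⟩ := exists_between hρ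
  refine summable_of_ratio_norm_eventually_le hs1 ?_
  filter_upwards [hr.norm.eventually_le_const hs] with n hn
  rw [norm_norm, norm_norm, hf, norm_mul]
  exact mul_le_mul_of_nonneg_right hn (norm_nonneg _)

theorem tendsto_const_mul_pow (a : ℂ) {q : ℂ} (hq : ‖q‖ < 1) :
    Tendsto (fun n : ℕ => a * q ^ n) atTop (𝓝 0) := by
  simpa using (tendsto_pow_atTop_nhds_zero_of_norm_lt_one hq).const_mul a

theorem tendsto_one_sub_mul_pow (a : ℂ) {q : ℂ} (hq : ‖q‖ < 1) :
    Tendsto (fun n : ℕ => 1 - a * q ^ n) atTop (𝓝 1) := by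
  simpa using (tendsto_const_mul_pow a hq).const_sub 1

/-- The coefficients of the `q`-binomial series in homogeneous form. -/
noncomputable def qBinomCoeff (a b q : ℂ) (m : ℕ) : ℂ :=
  (∏ i ∈ Finset.range m, (b - a * q ^ i)) / qPoch q q m

theorem qBinomCoeff_succ (a b : ℂ) {q : ℂ} (hq : ‖q‖ < 1) (m : ℕ) :
    qBinomCoeff a b q (m + 1) * (1 - q ^ (m + 1)) = qBinomCoeff a b q m * (b - a * q ^ m) := by
  have h0 := qPoch_ne_zero hq hq m
  have h1 := one_sub_mul_pow_ne_zero hq hq m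
  rw [qBinomCoeff, qBinomCoeff, qPoch_succ, Finset.prod_range_succ, pow_succ',
    div_mul_eq_mul_div, div_mul_eq_mul_div, div_eq_div_iff (mul_ne_zero h0 h1) h0]
  ring

theorem summable_norm_qBinomCoeff (a : ℂ) {b q z : ℂ} (hq : ‖q‖ < 1) (hz : ‖b * z‖ < 1) :
    Summable fun m => ‖qBinomCoeff a b q m * z ^ m‖ := by
  refine summable_norm_of_tendsto_ratio
    (r := fun m => (b - a * q ^ m) * z / (1 - q * q ^ m)) (fun m => ?_) ?_ hz
  · have h1 := one_sub_mul_pow_ne_zero hq hq m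
    have := qBinomCoeff_succ a b hq m
    rw [pow_succ' q] at this
    rw [div_mul_eq_mul_div, eq_div_iff h1, pow_succ]
    linear_combination z ^ m * z * this
  · have := (((tendsto_const_mul_pow a hq).const_sub b).mul_const z).div
      (tendsto_one_sub_mul_pow q hq) one_ne_zero
    simpa [Pi.div_def] using this

/-- Summing the recurrence `qBinomCoeff_succ` against `z ^ (m + 1)` evaluates `F(z) - F(zq)`, where
`F` is the series; its constant term cancels. -/
theorem tsum_qBinomCoeff_functional (a : ℂ) {b q z : ℂ} (hq : ‖q‖ < 1) (hz : ‖b * z‖ < 1) :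
    (1 - b * z) * ∑' m, qBinomCoeff a b q m * z ^ m =
      (1 - a * z) * ∑' m, qBinomCoeff a b q m * (z * q) ^ m := by
  have hz' : ‖b * (z * q)‖ < 1 := by
    simpa [mul_assoc] using norm_mul_pow_lt_one hz hq 1
  have s1 := (summable_norm_qBinomCoeff a hq hz).of_norm
  have s2 := (summable_norm_qBinomCoeff a hq hz').of_norm
  have h1 := (s1.sub s2).tsum_eq_zero_add
  rw [s1.tsum_sub s2] at h1
  have h2 : ∀ m, qBinomCoeff a b q (m + 1) * z ^ (m + 1) -
      qBinomCoeff a b q (m + 1) * (z * q) ^ (m + 1) =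
      b * z * (qBinomCoeff a b q m * z ^ m) - a * z * (qBinomCoeff a b q m * (z * q) ^ m) := by
    intro m
    have := qBinomCoeff_succ a b hq m
    rw [mul_pow, mul_pow, pow_succ z]
    linear_combination z ^ m * z * this
  simp only [h2] at h1
  rw [(s1.mul_left _).tsum_sub (s2.mul_left _), tsum_mul_left, tsum_mul_left] at h1
  simp only [pow_zero, sub_self, zero_add] at h1
  linear_combination h1

/-- The `q`-binomial theorem in homogeneous form. -/
theorem hasSum_qBinomCoeff (a : ℂ) {b q z : ℂ} (hq : ‖q‖ < 1) (hz : ‖b * z‖ < 1) :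
    HasSum (fun m => qBinomCoeff a b q m * z ^ m)
      (qPochInf (a * z) q / qPochInf (b * z) q) := by
  have s := summable_norm_qBinomCoeff a hq hz
  -- Iterating the functional equation pushes the argument to `z q^N → 0`, where only the term `m =
  -- 0` survives.
  have iter : ∀ N : ℕ, qPoch (b * z) q N * ∑' m, qBinomCoeff a b q m * z ^ m =
      qPoch (a * z) q N * ∑' m, qBinomCoeff a b q m * (z * q ^ N) ^ m := by
    intro N
    induction N with
    | zero => simp [qPoch]
    | succ N ih =>
      have hN : ‖b * (z * q ^ N)‖ < 1 := by
        simpa [mul_assoc] using norm_mul_pow_lt_one hz hq N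
      have := tsum_qBinomCoeff_functional a hq hN
      rw [mul_assoc z, ← pow_succ] at this
      rw [qPoch_succ, qPoch_succ]
      linear_combination (1 - b * z * q ^ N) * ih + qPoch (a * z) q N * this
  have lim : Tendsto (fun N : ℕ => ∑' m, qBinomCoeff a b q m * (z * q ^ N) ^ m) atTop
      (𝓝 (∑' m, if m = 0 then 1 else 0)) := by
    refine tendsto_tsum_of_dominated_convergence s (fun m => ?_)
      (Eventually.of_forall fun N m => ?_)
    · cases m with
      | zero => simp [qBinomCoeff, qPoch]
      | succ m =>
        have := ((tendsto_const_mul_pow z hq).pow (m + 1)).const_mul (qBinomCoeff a b q (m + 1))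
        simpa using this
    · rw [norm_mul, norm_mul, norm_pow, norm_pow, norm_mul, norm_pow]
      gcongr
      exact mul_le_of_le_one_right (norm_nonneg _) (pow_le_one₀ (norm_nonneg _) hq.le)
  rw [tsum_ite_eq] at lim
  have key := tendsto_nhds_unique
    (((tendsto_qPoch (b * z) hq).mul_const _).congr iter) ((tendsto_qPoch (a * z) hq).mul lim)
  rw [mul_one] at key
  rw [← key, mul_div_cancel_left₀ _ (qPochInf_ne_zero hz hq)]
  exact s.of_norm.hasSum

/-! ### Evaluation of the series as a product -/

theorem qBinomCoeff_one (a q : ℂ) (m : ℕ) : qBinomCoeff a 1 q m = qPoch a q m / qPoch q q m :=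
  rfl

/-- The degenerate case `b = 0` is Euler's expansion of `(-qz;q²)_∞`, with no restriction on `z`. -/
theorem qBinomCoeff_neg_one_zero (q z : ℂ) (m : ℕ) :
    qBinomCoeff (-1) 0 (q ^ 2) m * (q * z) ^ m =
      q ^ (m ^ 2) / qPoch (q ^ 2) (q ^ 2) m * z ^ m := by
  have h : (∏ i ∈ Finset.range m, (0 - -1 * (q ^ 2) ^ i)) * q ^ m = q ^ (m ^ 2) := by
    induction m with
    | zero => simp
    | succ m ih =>
      rw [Finset.prod_range_succ]
      linear_combination (q ^ 2) ^ m * q * ih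
  rw [qBinomCoeff, mul_pow, ← h]
  ring

theorem summable_qPoch_series {q : ℂ} (hq : ‖q‖ < 1) :
    Summable fun n : ℕ => ‖qPoch q (q ^ 2) n * q ^ (n ^ 2) / qPoch (q ^ 4) (q ^ 4) n‖ := by
  have h2 := norm_sq_lt_one hq
  have h4 : ‖q ^ 4‖ < 1 := by simpa [← pow_mul] using norm_sq_lt_one h2
  refine summable_norm_of_tendsto_ratio (ρ := 0)
    (r := fun n => (1 - q * (q ^ 2) ^ n) * (q * (q ^ 2) ^ n) / (1 - q ^ 4 * (q ^ 4) ^ n))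
    (fun n => ?_) ?_ (by simp)
  · rw [qPoch_succ, qPoch_succ, show (n + 1) ^ 2 = n ^ 2 + 2 * n + 1 by ring, pow_add, pow_add,
      pow_mul, div_mul_div_comm]
    congr 1 <;> ring
  · have := ((tendsto_one_sub_mul_pow q h2).mul (tendsto_const_mul_pow q h2)).div
      (tendsto_one_sub_mul_pow (q ^ 4) h4) one_ne_zero
    simpa [Pi.div_def] using this

theorem tsum_qPoch_series {q : ℂ} (hq : ‖q‖ < 1) :
    ∑' n : ℕ, qPoch q (q ^ 2) n * q ^ (n ^ 2) / qPoch (q ^ 4) (q ^ 4) n =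
      qPochInf (q ^ 2) (q ^ 4) ^ 2 / qPochInf q (q ^ 2) := by
  have h2 := norm_sq_lt_one hq
  have hn2 : ‖-q ^ 2‖ < 1 := by rwa [norm_neg]
  set u : ℕ → ℂ := fun n => q ^ (n ^ 2) / qPoch (q ^ 2) (q ^ 2) n
  set v : ℕ → ℂ := fun m => qBinomCoeff (-q) 1 (q ^ 2) m * q ^ m
  have hu : Summable fun n => ‖u n‖ := by
    have := summable_norm_qBinomCoeff (-1) (b := 0) (z := q * 1) h2 (by simp)
    simp only [qBinomCoeff_neg_one_zero] at this
    simpa [u] using this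
  have hv : Summable fun m => ‖v m‖ := summable_norm_qBinomCoeff (-q) h2 (by simpa using hq)
  have huv : Summable (Function.uncurry fun n m => u n * v m * (q ^ 2) ^ (n * m)) := by
    refine Summable.of_norm_bounded (summable_mul_of_summable_norm hu hv).norm fun p => ?_
    rw [Function.uncurry, norm_mul]
    refine mul_le_of_le_one_right (norm_nonneg _) ?_
    rw [norm_pow]
    exact pow_le_one₀ (norm_nonneg _) h2.le
  -- The sum over `m` is `(-q^(2n+2);q²)_∞ / (q^(2n+1);q²)_∞`; completing both tails to full
  -- products leaves the `n`-th term of the series.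
  have row : ∀ n, ∑' m, u n * v m * (q ^ 2) ^ (n * m) =
      qPochInf (-q ^ 2) (q ^ 2) / qPochInf q (q ^ 2) *
        (qPoch q (q ^ 2) n * q ^ (n ^ 2) / qPoch (q ^ 4) (q ^ 4) n) := by
    intro n
    have hz : ‖q * (q ^ 2) ^ n‖ < 1 := norm_mul_pow_lt_one hq h2 n
    have hs := (hasSum_qBinomCoeff (-q) (b := 1) h2 (by simpa only [one_mul] using hz)).tsum_eq
    have e : ∀ m, u n * v m * (q ^ 2) ^ (n * m) =
        u n * (qBinomCoeff (-q) 1 (q ^ 2) m * (q * (q ^ 2) ^ n) ^ m) := by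
      intro m
      simp only [v]
      rw [mul_pow q, ← pow_mul]
      ring
    simp only [e]
    rw [tsum_mul_left, hs, one_mul, show -q * (q * (q ^ 2) ^ n) = -q ^ 2 * (q ^ 2) ^ n by ring]
    have h1 := qPoch_mul_qPochInf q h2 n
    have h3 := qPoch_mul_qPochInf (-q ^ 2) h2 n
    have h5 := qPoch_mul_qPoch_neg (q ^ 2) (q ^ 2) n
    rw [← pow_mul] at h5
    rw [← h1, ← h3, ← h5]
    have n1 := qPoch_ne_zero hq h2 n
    have n2 := qPoch_ne_zero h2 h2 n
    have n3 := qPoch_ne_zero hn2 h2 n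
    have n4 := qPochInf_ne_zero hz h2
    simp only [u]
    field_simp
  -- Euler's sum over `n` is `(-q^(2m+1);q²)_∞`, exactly the tail missing from the factor
  -- `(-q;q²)_m` of `v m`.
  have col : ∀ m, ∑' n, u n * v m * (q ^ 2) ^ (n * m) =
      qPochInf (-q) (q ^ 2) * (qBinomCoeff 0 1 (q ^ 2) m * q ^ m) := by
    intro m
    have hs := (hasSum_qBinomCoeff (-1) (b := 0) (z := q * (q ^ 2) ^ m) h2 (by simp)).tsum_eq
    have e : ∀ n, u n * v m * (q ^ 2) ^ (n * m) =
        v m * (qBinomCoeff (-1) 0 (q ^ 2) n * (q * (q ^ 2) ^ m) ^ n) := by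
      intro n
      rw [qBinomCoeff_neg_one_zero]
      simp only [u]
      rw [← pow_mul, mul_comm n m]
      ring
    simp only [e]
    rw [tsum_mul_left, hs, ← qPoch_mul_qPochInf (-q) h2 m]
    simp only [v, qBinomCoeff_one]
    have : qPochInf (0 * (q * (q ^ 2) ^ m)) (q ^ 2) = 1 := by simp [qPochInf]
    rw [this, show qPoch 0 (q ^ 2) m = 1 by simp [qPoch],
      show -1 * (q * (q ^ 2) ^ m) = -q * (q ^ 2) ^ m by ring]
    ring
  have swap := huv.tsum_comm
  simp only [row, col] at swap
  rw [tsum_mul_left, tsum_mul_left,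
    (hasSum_qBinomCoeff 0 (b := 1) h2 (by simpa only [one_mul] using hq)).tsum_eq, one_mul,
    zero_mul, show qPochInf 0 (q ^ 2) = 1 by simp [qPochInf]] at swap
  -- These rewrite `(-q;q²)_∞ / (-q²;q²)_∞`: the denominator is inverse to `(q²;q⁴)_∞`, and the
  -- numerator is `(q²;q⁴)_∞ / (q;q²)_∞`.
  have h6 := qPochInf_neg_mul_qPochInf h2
  have h7 := qPochInf_mul_qPochInf_neg q h2
  rw [← pow_mul] at h6 h7
  have n1 := qPochInf_ne_zero hq h2
  rw [eq_div_iff n1]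
  field_simp at swap
  set S := ∑' n : ℕ, qPoch q (q ^ 2) n * q ^ (n ^ 2) / qPoch (q ^ 4) (q ^ 4) n
  set N := qPochInf (-q ^ 2) (q ^ 2)
  set D := qPochInf (q ^ 2) (q ^ 4)
  linear_combination (-S * qPochInf q (q ^ 2)) * h6 - qPochInf q (q ^ 2) * D * swap + D * h7

/-! ### Parametrisation of `P4` -/

/-- The least even number `t` such that `t + 1` or `t + 2` may be put in front of the list `l` of
parts in `P4`; the parts that may be are those congruent to `t + 1` or `t + 2` modulo `4`. -/
def base : List ℕ → ℕ
  | [] => 0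
  | x :: _ => x + 1 + (x + 1) % 2

theorem even_base (l : List ℕ) : Even (base l) := by
  cases l with
  | nil => exact Even.zero
  | cons x l => rw [base, Nat.even_iff]; omega

/-- The part with parameters `p` among those that may be put in front of `l`. -/
def nextPart (l : List ℕ) (p : Bool × ℕ) : ℕ := base l + 1 + p.1.toNat + 4 * p.2

theorem base_nextPart_cons (l : List ℕ) (p : Bool × ℕ) :
    base (nextPart l p :: l) = base l + (2 + 2 * p.1.toNat + 4 * p.2) := by
  have h := Nat.even_iff.1 (even_base l)
  rcases p with ⟨_ | _, k⟩ <;>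
    simp only [base, nextPart, Bool.toNat_false, Bool.toNat_true] at * <;>
    omega

theorem even_nextPart_iff (l : List ℕ) (p : Bool × ℕ) : Even (nextPart l p) ↔ p.1 = true := by
  have h := Nat.even_iff.1 (even_base l)
  rw [Nat.even_iff]
  rcases p with ⟨_ | _, k⟩ <;> simp [nextPart] <;> omega

theorem nextPart_injective (l : List ℕ) : Function.Injective (nextPart l) := by
  rintro ⟨_ | _, k⟩ ⟨_ | _, k'⟩ h <;>
    simp [nextPart] at h ⊢ <;> omega

theorem exists_nextPart_eq_iff (l : List ℕ) (x : ℕ) :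
    (∃ p, nextPart l p = x) ↔ base l < x ∧ (x - base l - 1) % 4 ≤ 1 := by
  constructor
  · rintro ⟨⟨_ | _, k⟩, rfl⟩ <;> simp only [nextPart, Bool.toNat_false, Bool.toNat_true] <;> omega
  · rintro ⟨h, h'⟩
    rcases Nat.le_one_iff_eq_zero_or_eq_one.1 h' with h' | h'
    · exact ⟨(false, (x - base l - 1) / 4), by simp only [nextPart, Bool.toNat_false]; omega⟩
    · exact ⟨(true, (x - base l - 1) / 4), by simp only [nextPart, Bool.toNat_true]; omega⟩

/-- Modulo 4, an odd `y` admits `y + 2` and `y + 3`, an even `y` admits `y + 3` and `y + 4`.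
Rounding up to an even base makes the two cases uniform. -/
theorem gapCondition_and_lt_iff (x y : ℕ) (l : List ℕ) :
    GapCondition x y ∧ y < x ↔ ∃ p, nextPart (y :: l) p = x := by
  rw [exists_nextPart_eq_iff]
  simp only [GapCondition, base, Nat.odd_iff, Nat.even_iff, Int.ModEq]
  rcases Nat.mod_two_eq_zero_or_one x with hx | hx <;>
    rcases Nat.mod_two_eq_zero_or_one y with hy | hy <;> simp [hx, hy] <;> omega

theorem isStrictPartition_cons_cons (x y : ℕ) (l : List ℕ) :
    IsStrictPartition (x :: y :: l) ↔ y < x ∧ IsStrictPartition (y :: l) := by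
  simp only [IsStrictPartition, IsPartition, List.pairwise_cons, List.nodup_cons, List.mem_cons,
    forall_eq_or_imp, not_or]
  constructor
  · rintro ⟨⟨⟨⟨h1, -⟩, h2⟩, -, h3⟩, ⟨h4, -⟩, h5⟩
    exact ⟨lt_of_le_of_ne h1 (Ne.symm h4), ⟨h2, h3⟩, h5⟩
  · rintro ⟨h, ⟨⟨h1, h2⟩, h3, h4⟩, h5⟩
    exact ⟨⟨⟨⟨h.le, fun a ha => (h1 a ha).trans h.le⟩, h1, h2⟩, by omega, h3, h4⟩,
      ⟨h.ne', fun hx => absurd (h1 x hx) (not_le.2 h)⟩, h5⟩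

theorem nil_mem_P4 : [] ∈ P4 := by
  simp [P4, IsStrictPartition, IsPartition]

/-- The condition on the smallest part becomes the same rule, through `base [] = 0`. -/
theorem cons_mem_P4_iff (x : ℕ) (l : List ℕ) :
    x :: l ∈ P4 ↔ l ∈ P4 ∧ ∃ p, nextPart l p = x := by
  cases l with
  | nil =>
    rw [exists_nextPart_eq_iff]
    simp [P4, IsStrictPartition, IsPartition, base, Nat.ModEq]
    omega
  | cons y l =>
    rw [← gapCondition_and_lt_iff]
    simp only [P4, Set.mem_ofPred_eq, isStrictPartition_cons_cons, List.isChain_cons_cons,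
      List.getLast?_cons_cons]
    tauto

/-- The element of `P4` with the given parameters, those of the largest part first. -/
def ofParams : List (Bool × ℕ) → List ℕ
  | [] => []
  | p :: t => nextPart (ofParams t) p :: ofParams t

theorem ofParams_injective : Function.Injective ofParams := by
  intro s
  induction s with
  | nil =>
    rintro (_ | _) h
    · rfl
    · simp [ofParams] at h
  | cons p s ih =>
    rintro (_ | ⟨p', s'⟩) h
    · simp [ofParams] at h
    · rw [ofParams, ofParams, List.cons.injEq] at h
      obtain rfl := ih h.2
      rw [nextPart_injective _ h.1]

theorem range_ofParams : Set.range ofParams = P4 := by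
  ext l
  induction l with
  | nil => exact iff_of_true ⟨[], rfl⟩ nil_mem_P4
  | cons x l ih =>
    rw [cons_mem_P4_iff, ← ih]
    constructor
    · rintro ⟨_ | ⟨p, t⟩, h⟩
      · simp [ofParams] at h
      · rw [ofParams, List.cons.injEq] at h
        obtain ⟨h, rfl⟩ := h
        exact ⟨⟨t, rfl⟩, p, h⟩
    · rintro ⟨⟨t, rfl⟩, p, rfl⟩
      exact ⟨p :: t, rfl⟩

/-- The elements of `P4` correspond to the tuples of parameters. -/
noncomputable def sigmaEquivP4 : (Σ n, Fin n → Bool × ℕ) ≃ P4 :=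
  List.equivSigmaTuple.symm.trans
    ((Equiv.ofInjective _ ofParams_injective).trans (Equiv.setCongr range_ofParams))

theorem coe_sigmaEquivP4 (s : Σ n, Fin n → Bool × ℕ) :
    (sigmaEquivP4 s : List ℕ) = ofParams (List.ofFn s.2) :=
  rfl

/-! ### Generating function by number of parts -/

/-- The weight of a list of parts, refined by its `base` and with an arbitrary sign `s`. -/
noncomputable def weight (s q y : ℂ) (l : List ℕ) : ℂ :=
  s ^ numEven l * q ^ l.sum * y ^ base l

/-- The contribution of one part to `weight`. -/
noncomputable def partWeight (s q y : ℂ) (p : Bool × ℕ) : ℂ :=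
  s ^ p.1.toNat * q ^ (1 + p.1.toNat + 4 * p.2) * y ^ (2 + 2 * p.1.toNat + 4 * p.2)

/-- The new part contributes `q ^ base l` to the weight of the size; it merges with `y ^ base l`
into `(q * y) ^ base l`. -/
theorem weight_nextPart_cons (s q y : ℂ) (l : List ℕ) (p : Bool × ℕ) :
    weight s q y (nextPart l p :: l) =
      partWeight s q y p * weight s q (q * y) l := by
  have h : numEven (nextPart l p :: l) = numEven l + p.1.toNat := by
    rw [numEven, List.countP_cons, numEven]
    rcases p with ⟨_ | _, k⟩ <;> simp [even_nextPart_iff]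
  rw [weight, weight, h, base_nextPart_cons, List.sum_cons]
  simp only [partWeight, nextPart, pow_add, mul_pow]
  ring

/-- The generating function of the choices for one part. -/
theorem summable_norm_and_tsum_partWeight (s : ℂ) {q y : ℂ} (hq : ‖q‖ < 1) (hy : ‖y‖ ≤ 1) :
    (Summable fun p => ‖partWeight s q y p‖) ∧
    ∑' p, partWeight s q y p =
      q * y ^ 2 * (1 + s * (q * y ^ 2)) / (1 - q ^ 4 * y ^ 4) := by
  have hqy : ‖q ^ 4 * y ^ 4‖ < 1 := by
    rw [← mul_pow, norm_pow, norm_mul]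
    exact pow_lt_one₀ (by positivity)
      (mul_lt_one_of_nonneg_of_lt_one_left (norm_nonneg _) hq hy) four_ne_zero
  have e : ∀ p : Bool × ℕ, partWeight s q y p =
      (s ^ p.1.toNat * q ^ (1 + p.1.toNat) * y ^ (2 + 2 * p.1.toNat)) * (q ^ 4 * y ^ 4) ^ p.2 := by
    intro p
    rw [partWeight, mul_pow, ← pow_mul, ← pow_mul]
    ring
  have hf : Summable fun b : Bool =>
    ‖s ^ b.toNat * q ^ (1 + b.toNat) * y ^ (2 + 2 * b.toNat)‖ := (hasSum_fintype _).summable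
  have hg : Summable fun k : ℕ => ‖(q ^ 4 * y ^ 4) ^ k‖ :=
    summable_norm_geometric_of_norm_lt_one hqy
  simp only [e]
  refine ⟨hf.mul_norm hg, ?_⟩
  rw [← tsum_mul_tsum_of_summable_norm hf hg, tsum_geometric_of_norm_lt_one hqy, tsum_bool]
  simp
  ring

/-- The generating function of the elements of `P4` with `n` parts. -/
theorem summable_norm_and_tsum_weight (s : ℂ) {q : ℂ} (hq : ‖q‖ < 1) (n : ℕ) : ∀ y : ℂ, ‖y‖ ≤ 1 →
    (Summable fun t : Fin n → Bool × ℕ => ‖weight s q y (ofParams (List.ofFn t))‖) ∧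
    ∑' t : Fin n → Bool × ℕ, weight s q y (ofParams (List.ofFn t)) =
      ∏ i ∈ Finset.range n, q ^ (2 * i + 1) * y ^ 2 * (1 + s * (q ^ (2 * i + 1) * y ^ 2)) /
        (1 - (q ^ 4) ^ (i + 1) * y ^ 4) := by
  induction n with
  | zero =>
    intro y _
    refine ⟨(hasSum_fintype _).summable, ?_⟩
    simp [weight, ofParams, numEven, base]
  | succ n ih =>
    intro y hy
    have hqy : ‖q * y‖ ≤ 1 := by
      rw [norm_mul]
      exact mul_le_one₀ hq.le (norm_nonneg _) hy
    obtain ⟨h1, h2⟩ := summable_norm_and_tsum_partWeight s hq hy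
    obtain ⟨h3, h4⟩ := ih (q * y) hqy
    have e : ∀ p : (Bool × ℕ) × (Fin n → Bool × ℕ),
        weight s q y (ofParams (List.ofFn (Fin.consEquiv (fun _ => Bool × ℕ) p))) =
        partWeight s q y p.1 * weight s q (q * y) (ofParams (List.ofFn p.2)) := by
      intro p
      rw [← weight_nextPart_cons]
      simp [Fin.consEquiv, ofParams]
    rw [← (Fin.consEquiv fun _ : Fin (n + 1) => Bool × ℕ).tsum_eq,
      ← (Fin.consEquiv fun _ : Fin (n + 1) => Bool × ℕ).summable_iff]
    simp only [Function.comp_def, e]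
    obtain ⟨g, hg⟩ : ∃ g : (Fin n → Bool × ℕ) → ℂ,
        ∀ t, weight s q (q * y) (ofParams (List.ofFn t)) = g t := ⟨_, fun _ => rfl⟩
    simp only [hg] at h3 h4 ⊢
    refine ⟨h1.mul_norm h3, ?_⟩
    -- The factor `i = 0` belongs to the largest part; replacing `y` by `q * y` shifts the index of
    -- the others by one.
    rw [← tsum_mul_tsum_of_summable_norm h1 h3, h2, h4, Finset.prod_range_succ', mul_comm]
    congr 1
    · refine Finset.prod_congr rfl fun i _ => ?_
      congr 1 <;> ring
    · simp

theorem tsum_weight_one {q : ℂ} (hq : ‖q‖ < 1) (n : ℕ) :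
    ∑' t : Fin n → Bool × ℕ, weight (-1) q 1 (ofParams (List.ofFn t)) =
      qPoch q (q ^ 2) n * q ^ (n ^ 2) / qPoch (q ^ 4) (q ^ 4) n := by
  rw [(summable_norm_and_tsum_weight (-1) hq n 1 (by simp)).2]
  induction n with
  | zero => simp [qPoch]
  | succ n ih =>
    rw [Finset.prod_range_succ, ih, qPoch_succ, qPoch_succ, div_mul_div_comm]
    congr 1 <;> ring

theorem summable_norm_prod_parts (s : ℂ) {q : ℂ} (hq : ‖q‖ < 1) :
    Summable fun n : ℕ => ‖∏ i ∈ Finset.range n,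
      q ^ (2 * i + 1) * 1 ^ 2 * (1 + s * (q ^ (2 * i + 1) * 1 ^ 2)) /
        (1 - (q ^ 4) ^ (i + 1) * 1 ^ 4)‖ := by
  refine summable_norm_of_tendsto_ratio (ρ := 0) (fun n => Finset.prod_range_succ_comm _ n) ?_
    (by simp)
  have h2 := norm_sq_lt_one hq
  have h4 : ‖q ^ 4‖ < 1 := by simpa [← pow_mul] using norm_sq_lt_one h2
  have t1 : Tendsto (fun n : ℕ => q ^ (2 * n + 1)) atTop (𝓝 0) :=
    (tendsto_const_mul_pow q h2).congr fun n => by ring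
  have t2 : Tendsto (fun n : ℕ => 1 - (q ^ 4) ^ (n + 1)) atTop (𝓝 1) :=
    (tendsto_one_sub_mul_pow (q ^ 4) h4).congr fun n => by ring
  have := (t1.mul ((t1.const_mul s).const_add 1)).div t2 one_ne_zero
  simpa [Pi.div_def] using this

/-- Norms of the signed weights are the weights with `s = 1` at `‖q‖`, so the product formula for
that sign also computes the sums of norms. -/
theorem summable_weight_one {q : ℂ} (hq : ‖q‖ < 1) :
    Summable fun l : P4 => ‖weight (-1) q 1 l.1‖ := by
  have hr : ‖((‖q‖ : ℝ) : ℂ)‖ < 1 := by simpa using hq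
  have e : ∀ l : List ℕ, ‖weight (-1) q 1 l‖ = ‖weight 1 (‖q‖ : ℝ) 1 l‖ := by
    intro l
    simp [weight]
  have e' : ∀ l : List ℕ, weight 1 (‖q‖ : ℝ) 1 l = (‖weight 1 (‖q‖ : ℝ) 1 l‖ : ℝ) := by
    intro l
    simp [weight]
  simp only [e]
  rw [← sigmaEquivP4.summable_iff]
  simp only [Function.comp_def, coe_sigmaEquivP4]
  rw [summable_sigma_of_nonneg fun _ => norm_nonneg _]
  have hs := fun n => summable_norm_and_tsum_weight 1 hr n 1 (by simp)
  refine ⟨fun n => (hs n).1, ?_⟩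
  rw [← Complex.summable_ofReal]
  simp only [Complex.ofReal_tsum, ← e', (hs _).2]
  exact (summable_norm_prod_parts 1 hr).of_norm

theorem tsum_P4_eq_tsum_tsum {f : List ℕ → ℂ} (hf : Summable fun l : P4 => ‖f l.1‖) :
    ∑' l : P4, f l.1 = ∑' n : ℕ, ∑' t : Fin n → Bool × ℕ, f (ofParams (List.ofFn t)) := by
  have h : Summable fun s => f (sigmaEquivP4 s : List ℕ) :=
    (sigmaEquivP4.summable_iff (f := fun l : P4 => f l.1)).2 hf.of_norm
  rw [← sigmaEquivP4.tsum_eq, h.tsum_sigma]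
  rfl

theorem tsum_P4 {q : ℂ} (hq : ‖q‖ < 1) :
    ∑' l : P4, weight (-1) q 1 l.1 =
      ∑' n : ℕ, qPoch q (q ^ 2) n * q ^ (n ^ 2) / qPoch (q ^ 4) (q ^ 4) n := by
  have h := tsum_P4_eq_tsum_tsum (f := weight (-1) q 1) (summable_weight_one hq)
  exact h.trans (tsum_congr (tsum_weight_one hq))

end RestrictedGap

theorem mainTheorem4 (q : ℂ) (hq : ‖q‖ < 1) :
    (Summable fun l : RestrictedGap.P4 =>
      (-1 : ℂ) ^ RestrictedGap.numEven l.1 * q ^ l.1.sum) ∧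
    (Summable fun n : ℕ =>
      RestrictedGap.qPoch q (q ^ 2) n * q ^ (n ^ 2) / RestrictedGap.qPoch (q ^ 4) (q ^ 4) n) ∧
    (∑' l : RestrictedGap.P4, (-1 : ℂ) ^ RestrictedGap.numEven l.1 * q ^ l.1.sum) =
      ∑' n : ℕ,
        RestrictedGap.qPoch q (q ^ 2) n * q ^ (n ^ 2) / RestrictedGap.qPoch (q ^ 4) (q ^ 4) n ∧
    (∑' n : ℕ,
        RestrictedGap.qPoch q (q ^ 2) n * q ^ (n ^ 2) / RestrictedGap.qPoch (q ^ 4) (q ^ 4) n) =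
      RestrictedGap.qPochInf (q ^ 2) (q ^ 4) ^ 2 / RestrictedGap.qPochInf q (q ^ 2) := by
  have e : ∀ l : List ℕ, (-1 : ℂ) ^ RestrictedGap.numEven l * q ^ l.sum =
      RestrictedGap.weight (-1) q 1 l := fun l => by simp [RestrictedGap.weight]
  simp only [e]
  exact ⟨(RestrictedGap.summable_weight_one hq).of_norm,
    (RestrictedGap.summable_qPoch_series hq).of_norm, RestrictedGap.tsum_P4 hq,
    RestrictedGap.tsum_qPoch_series hq⟩
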